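/- Let $p$ be a prime and let $G=D_{2p^2}=\langle a,b : a^{p^2}=b^2=1,\ bab=a^{-1}\rangle$ be the dihedral group of order $2p^2$. Let $\mathcal{B}(G)$ be the subgroup generating bipartite graph of $G$: its vertex set is the disjoint union of $G\times G$ and the set $L(G)$ of all subgroups of $G$, and its edges join each pair $(x,y)\in G\times G$ to the subgroup $\langle x,y\rangle\in L(G)$. For a finite simple graph $\mathcal{G}$ with adjacency matrix $A$ and degree matrix $D$, let $\mathrm{Spec}$, $\mathrm{L\text{-}Spec}$, $\mathrm{Q\text{-}Spec}$ and $\mathrm{CN\text{-}Spec}$ of $\mathcal{G}$ be the multisets of eigenvalues of $A$, $D-A$, $D+A$ and $CN$ respectively, where $CN$ is the common neighborhood matrix, whose entry at two distinct vertices is the number of their common neighbors and whose diagonal entries are $0$. Write $\{(x_1)^{n_1},\dots,(x_k)^{n_k}\}$ for the multiset containing $x_i$ with multiplicity $n_i$ (if some of the listed values coincide, their multiplicities are added). Then $$\begin{aligned}\mathrm{Spec}(\mathcal{B}(G))=\Big\{&(0)^{4p^4-p^2-p-4},(-1)^1,(1)^1,(\sqrt3)^{p^2},(-\sqrt3)^{p^2},(\sqrt{p^2-1})^1,(-\sqrt{p^2-1})^1,\\&(\sqrt{p^4-p^2})^1,(-\sqrt{p^4-p^2})^1,(\sqrt{3p^2-3p})^p,(-\sqrt{3p^2-3p})^p,\\&(\sqrt{3p^4-3p^3})^1,(-\sqrt{3p^4-3p^3})^1\Big\},\end{aligned}$$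 $$\begin{aligned}\mathrm{L\text{-}Spec}(\mathcal{B}(G))=\Big\{&(0)^{p^2+p+4},(1)^{4p^4-p^2-p-4},(2)^1,(4)^{p^2},(p^2)^1,(p^4-p^2+1)^1,\\&(3p^2-3p+1)^p,(3p^4-3p^3+1)^1\Big\}=\mathrm{Q\text{-}Spec}(\mathcal{B}(G)),\end{aligned}$$ and $$\begin{aligned}\mathrm{CN\text{-}Spec}(\mathcal{B}(G))=\Big\{&(0)^{p^2+p+5},(-1)^{4p^4-p^2-p-4},(2)^{p^2},(p^2-2)^1,(p^4-p^2-1)^1,\\&(3p^2-3p-1)^p,(3p^4-3p^3-1)^1\Big\}.\end{aligned}$$ -/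

import Mathlib

open scoped Classical in
/-- The signless Laplacian matrix `D + A` of a finite simple graph. -/
noncomputable def signlessLapMatrix {V : Type*} [Fintype V] (Γ : SimpleGraph V) :
    Matrix V V ℝ :=
  Γ.degMatrix ℝ + Γ.adjMatrix ℝ

open scoped Classical in
/-- The common neighborhood matrix of a simple graph: for `v ≠ w` the entry at `(v, w)` is the
number of common neighbors of `v` and `w`, and the diagonal entries are `0`. (A common neighbor of
`v` and `w` is different from both, since adjacency is irreflexive.) -/
noncomputable def cnMatrix {V : Type*} (Γ : SimpleGraph V) : Matrix V V ℝ :=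
  Matrix.of fun v w => if v = w then 0 else ((Γ.commonNeighbors v w).ncard : ℝ)

open scoped Classical in
/-- The multiset of real eigenvalues of a square real matrix, each with its multiplicity as a root
of the characteristic polynomial. It is applied to symmetric matrices only, for which all
eigenvalues are real and algebraic and geometric multiplicities agree. -/
noncomputable def eigenvalueMultiset {V : Type*} [Fintype V] (M : Matrix V V ℝ) : Multiset ℝ :=
  M.charpoly.roots

open scoped Classical in
/-- The spectrum of a finite simple graph. -/
noncomputable def graphSpec {V : Type*} [Fintype V] (Γ : SimpleGraph V) : Multiset ℝ :=
  eigenvalueMultiset (Γ.adjMatrix ℝ)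

open scoped Classical in
/-- The Laplacian spectrum of a finite simple graph. -/
noncomputable def graphLSpec {V : Type*} [Fintype V] (Γ : SimpleGraph V) : Multiset ℝ :=
  eigenvalueMultiset (Γ.lapMatrix ℝ)

/-- The signless Laplacian spectrum of a finite simple graph. -/
noncomputable def graphQSpec {V : Type*} [Fintype V] (Γ : SimpleGraph V) : Multiset ℝ :=
  eigenvalueMultiset (signlessLapMatrix Γ)

/-- The common neighborhood spectrum of a finite simple graph. -/
noncomputable def graphCNSpec {V : Type*} [Fintype V] (Γ : SimpleGraph V) : Multiset ℝ :=
  eigenvalueMultiset (cnMatrix Γ)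

/-- The subgroup generating bipartite graph of a group `G`: its vertex set is the disjoint union of
`G × G` and the set of subgroups of `G`, and its edges join `(a, b)` to the subgroup generated by
`a` and `b`. -/
def sgbGraph (G : Type*) [Group G] : SimpleGraph ((G × G) ⊕ Subgroup G) where
  Adj x y :=
    match x, y with
    | Sum.inl (a, b), Sum.inr H => Subgroup.closure {a, b} = H
    | Sum.inr H, Sum.inl (a, b) => Subgroup.closure {a, b} = H
    | _, _ => False
  symm := ⟨by rintro (⟨a, b⟩ | H) (⟨c, d⟩ | K) h <;> exact h⟩
  loopless := ⟨by rintro (⟨a, b⟩ | H) h <;> exact h⟩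

/-!
Every pair `(x, y)` is adjacent to exactly one subgroup, namely `pairClosure (x, y)`. So
`sgbGraph G` is a disjoint union of stars, one for each subgroup `K`, whose number of leaves is the
number `m` of pairs generating `K`. Writing the matrices in blocks in terms of the incidence matrix
`B` of the map `pairClosure`, whose Gram matrix `Bᵀ * B` is diagonal with entries `m`, a Schur
complement (`det_fromBlocks_incidence`) gives the characteristic polynomials: a subgroup `K`
contributes the eigenvalues `±√m` to the spectrum, `0` and `m + 1` to both Laplacian spectra, and
`0` and `m - 1` to the common neighborhood spectrum, and what remains is one constant eigenvalue
(`0`, `1` or `-1`) of multiplicity `|G × G| - |L(G)|`.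

It remains to find the numbers `m`. A subgroup of `DihedralGroup n` is determined by an additive
subgroup `A` of `ZMod n`, giving its rotations, and either no reflection at all or a coset of `A`
giving its reflections (`bijective_subgroup_param`). In the first case `m` is the number of pairs
generating `A`, in the second it is `3 * |A|` times the number of generators of `A`
(`fiberCard_reflSub`). For `n = p ^ 2` the only possibilities for `A` are the members of the chain
`⊥ < midSub p < ⊤`, so all counts follow by subtraction, and `sum_fiberCard_dihedral` collects them.
-/

/-! ### Spectra of star forests -/

open Polynomial in
/-- It suffices to know the characteristic polynomial away from a single point `z`: a
factorization of `det (t - M)` into linear factors for all `t ≠ z` gives all the roots. -/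
theorem roots_charpoly_of_det_eq {V Y : Type*} [Fintype V] [DecidableEq V] [Fintype Y]
    (M : Matrix V V ℝ) (z : ℝ) (k : ℕ) (a b : Y → ℝ)
    (h : ∀ t, t ≠ z →
      (Matrix.scalar V t - M).det = (t - z) ^ k * ∏ y, ((t - a y) * (t - b y))) :
    M.charpoly.roots = Multiset.replicate k z + ∑ y, {a y, b y} := by
  have hP : M.charpoly = (X - C z) ^ k * ∏ y, ((X - C (a y)) * (X - C (b y))) := by
    refine Polynomial.eq_of_infinite_eval_eq _ _ ((Set.finite_singleton z).infinite_compl.mono ?_)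
    intro t ht
    simp only [Set.mem_ofPred_eq, Matrix.eval_charpoly, h t ht]
    simp [Polynomial.eval_prod]
  have hne : ∀ y, (X - C (a y)) * (X - C (b y)) ≠ 0 := fun y =>
    mul_ne_zero (X_sub_C_ne_zero _) (X_sub_C_ne_zero _)
  have hprod : ∏ y, ((X - C (a y)) * (X - C (b y))) ≠ 0 :=
    Finset.prod_ne_zero_iff.2 fun y _ => hne y
  rw [hP, roots_mul (mul_ne_zero (pow_ne_zero _ (X_sub_C_ne_zero _)) hprod), roots_pow,
    roots_X_sub_C, Multiset.nsmul_singleton, roots_prod _ _ hprod]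
  congr 1
  change Multiset.sum (Multiset.map _ _) = Multiset.sum (Multiset.map _ _)
  congr 1
  refine Multiset.map_congr rfl fun y _ => ?_
  rw [roots_mul (hne y), roots_X_sub_C, roots_X_sub_C]
  rfl

/-- The `0`-`1` incidence matrix of a map `f : X → Y`, with entry `1` at `(x, f x)`. -/
def incidence {X Y : Type*} [DecidableEq Y] (f : X → Y) : Matrix X Y ℝ :=
  Matrix.of fun x y => if f x = y then 1 else 0

/-- The size of the fiber of `f` over `y`. -/
def fiberCard {X Y : Type*} [Fintype X] [DecidableEq Y] (f : X → Y) (y : Y) : ℕ :=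
  (Finset.univ.filter fun x => f x = y).card

theorem incidence_transpose_mul {X Y : Type*} [Fintype X] [DecidableEq Y] (f : X → Y) :
    (incidence f).transpose * incidence f = Matrix.diagonal fun y => (fiberCard f y : ℝ) := by
  ext y y'
  simp only [Matrix.mul_apply, Matrix.transpose_apply, incidence, Matrix.of_apply,
    Matrix.diagonal_apply, fiberCard, ← ite_and, ite_mul, one_mul, zero_mul]
  split_ifs with h
  · subst h
    simp
  · refine Finset.sum_eq_zero fun x _ => if_neg ?_
    rintro ⟨rfl, h'⟩
    exact h h'

/-- The Schur complement of the block `a • 1`, cleared of denominators. -/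
theorem det_fromBlocks_incidence {X Y : Type*} [Fintype X] [DecidableEq X] [Fintype Y]
    [DecidableEq Y] (f : X → Y) (hc : Fintype.card Y ≤ Fintype.card X) (a b : ℝ) (ha : a ≠ 0)
    (d : Y → ℝ) :
    (Matrix.fromBlocks (a • 1) (b • incidence f) (b • (incidence f).transpose)
      (Matrix.diagonal d)).det =
      a ^ (Fintype.card X - Fintype.card Y) * ∏ y, (a * d y - b ^ 2 * fiberCard f y) := by
  let : Invertible (a • (1 : Matrix X X ℝ)) :=
    ⟨a⁻¹ • 1, by simp [smul_smul, ha], by simp [smul_smul, ha]⟩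
  have hinv : ⅟(a • (1 : Matrix X X ℝ)) = a⁻¹ • 1 := rfl
  rw [Matrix.det_fromBlocks₁₁, hinv]
  have : Matrix.diagonal d -
      (b • (incidence f).transpose) * (a⁻¹ • (1 : Matrix X X ℝ)) * (b • incidence f) =
      Matrix.diagonal fun y => d y - b ^ 2 * a⁻¹ * fiberCard f y := by
    have h1 : (b • (incidence f).transpose) * (a⁻¹ • (1 : Matrix X X ℝ)) * (b • incidence f) =
        (b ^ 2 * a⁻¹) • Matrix.diagonal fun y => (fiberCard f y : ℝ) := by
      rw [← incidence_transpose_mul]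
      simp only [Matrix.smul_mul, Matrix.mul_smul, Matrix.mul_one, smul_smul]
      congr 1
      ring
    rw [h1, ← Matrix.diagonal_smul, Matrix.diagonal_sub]
    rfl
  rw [this, Matrix.det_diagonal, Matrix.det_smul, Matrix.det_one, mul_one]
  have h2 : ∀ y, a * d y - b ^ 2 * fiberCard f y = a * (d y - b ^ 2 * a⁻¹ * fiberCard f y) := by
    intro y
    field_simp
  simp_rw [h2]
  rw [Finset.prod_mul_distrib, Finset.prod_const, Finset.card_univ, ← mul_assoc, ← pow_add,
    Nat.sub_add_cancel hc]

section StarForest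

variable {X Y : Type*} [Fintype X] [DecidableEq X] [Fintype Y] [DecidableEq Y]
  [DecidableEq (X ⊕ Y)]

theorem roots_charpoly_adj_block (f : X → Y) (hc : Fintype.card Y ≤ Fintype.card X) :
    (Matrix.fromBlocks 0 (incidence f) (incidence f).transpose 0 :
      Matrix (X ⊕ Y) (X ⊕ Y) ℝ).charpoly.roots =
      Multiset.replicate (Fintype.card X - Fintype.card Y) 0 +
        ∑ y, {√(fiberCard f y : ℝ), -√(fiberCard f y : ℝ)} := by
  refine roots_charpoly_of_det_eq _ _ _ _ _ fun t ht => ?_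
  have : Matrix.scalar (X ⊕ Y) t -
      Matrix.fromBlocks 0 (incidence f) (incidence f).transpose 0 =
      Matrix.fromBlocks (t • 1) ((-1 : ℝ) • incidence f) ((-1 : ℝ) • (incidence f).transpose)
        (Matrix.diagonal fun _ => t) := by
    ext (i | i) (j | j) <;> simp [Matrix.diagonal_apply, Matrix.one_apply]
  rw [this]
  convert det_fromBlocks_incidence f hc t (-1) ht (fun _ => t) using 2
  · rw [sub_zero]
  · refine Finset.prod_congr rfl fun y _ => ?_
    have := Real.mul_self_sqrt (Nat.cast_nonneg (α := ℝ) (fiberCard f y))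
    linear_combination -this

/-- The blocks of the Laplacian (`b = -1`) and of the signless Laplacian (`b = 1`): the sign of the
off-diagonal blocks does not matter, since only `b ^ 2` enters the Schur complement. -/
theorem roots_charpoly_lap_block (f : X → Y) (hc : Fintype.card Y ≤ Fintype.card X) (b : ℝ)
    (hb : b ^ 2 = 1) :
    (Matrix.fromBlocks 1 (b • incidence f) (b • (incidence f).transpose)
      (Matrix.diagonal fun y => (fiberCard f y : ℝ)) : Matrix (X ⊕ Y) (X ⊕ Y) ℝ).charpoly.roots =
      Multiset.replicate (Fintype.card X - Fintype.card Y) 1 +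
        ∑ y, {(0 : ℝ), (fiberCard f y : ℝ) + 1} := by
  refine roots_charpoly_of_det_eq _ _ _ _ _ fun t ht => ?_
  have : Matrix.scalar (X ⊕ Y) t -
      Matrix.fromBlocks 1 (b • incidence f) (b • (incidence f).transpose)
        (Matrix.diagonal fun y => (fiberCard f y : ℝ)) =
      Matrix.fromBlocks ((t - 1) • 1) ((-b) • incidence f) ((-b) • (incidence f).transpose)
        (Matrix.diagonal fun y => t - fiberCard f y) := by
    ext (i | i) (j | j) <;> simp [Matrix.diagonal_apply, Matrix.one_apply] <;> split_ifs <;> simp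
  rw [this]
  convert det_fromBlocks_incidence f hc (t - 1) (-b) (sub_ne_zero.2 ht) _ using 2
  refine Finset.prod_congr rfl fun y _ => ?_
  linear_combination (fiberCard f y : ℝ) * hb

theorem roots_charpoly_cn_block (f : X → Y) (hc : Fintype.card Y ≤ Fintype.card X) :
    (Matrix.fromBlocks (incidence f * (incidence f).transpose - 1) 0 0 0 :
      Matrix (X ⊕ Y) (X ⊕ Y) ℝ).charpoly.roots =
      Multiset.replicate (Fintype.card X - Fintype.card Y) (-1) +
        ∑ y, {(0 : ℝ), (fiberCard f y : ℝ) - 1} := by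
  refine roots_charpoly_of_det_eq _ _ _ _ _ fun t ht => ?_
  have : Matrix.scalar (X ⊕ Y) t -
      Matrix.fromBlocks (incidence f * (incidence f).transpose - 1) 0 0 0 =
      Matrix.fromBlocks ((t + 1) • 1 - incidence f * (incidence f).transpose) 0 0
        (Matrix.diagonal fun _ => t) := by
    ext (i | i) (j | j)
    · simp [Matrix.diagonal_apply, Matrix.one_apply]
      split_ifs <;> ring
    all_goals simp [Matrix.diagonal_apply]
  -- Eliminating the other diagonal block `1` instead turns `det_fromBlocks_incidence` into a
  -- formula for this determinant.
  have h2 : ((t + 1) • 1 - incidence f * (incidence f).transpose).det =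
      (t + 1) ^ (Fintype.card X - Fintype.card Y) * ∏ y, (t + 1 - fiberCard f y) := by
    have h := det_fromBlocks_incidence f hc (t + 1) 1
      (fun h0 => ht (eq_neg_of_add_eq_zero_left h0)) (fun _ => 1)
    rw [Matrix.diagonal_one, Matrix.det_fromBlocks_one₂₂] at h
    simpa using h
  rw [this]
  have h3 := Matrix.det_fromBlocks_zero₂₁ ((t + 1) • 1 - incidence f * (incidence f).transpose) 0
    (Matrix.diagonal fun _ : Y => t)
  rw [h2, Matrix.det_diagonal, mul_assoc, ← Finset.prod_mul_distrib] at h3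
  convert h3 using 2
  · ring
  · exact Finset.prod_congr rfl fun y _ => by ring

end StarForest

/-! ### The subgroup generating bipartite graph -/

/-- The subgroup generated by a pair of elements. -/
def pairClosure {G : Type*} [Group G] (q : G × G) : Subgroup G := Subgroup.closure {q.1, q.2}

section Graph

variable {G : Type*} [Group G]

@[simp] theorem sgbGraph_adj_inl_inl (q q' : G × G) :
    ¬ (sgbGraph G).Adj (Sum.inl q) (Sum.inl q') := id

@[simp] theorem sgbGraph_adj_inr_inr (H K : Subgroup G) :
    ¬ (sgbGraph G).Adj (Sum.inr H) (Sum.inr K) := id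

@[simp] theorem sgbGraph_adj_inl_inr (q : G × G) (K : Subgroup G) :
    (sgbGraph G).Adj (Sum.inl q) (Sum.inr K) ↔ pairClosure q = K := Iff.rfl

@[simp] theorem sgbGraph_adj_inr_inl (q : G × G) (K : Subgroup G) :
    (sgbGraph G).Adj (Sum.inr K) (Sum.inl q) ↔ pairClosure q = K := Iff.rfl

open scoped Classical in
theorem sgbGraph_adjMatrix :
    (sgbGraph G).adjMatrix ℝ = Matrix.fromBlocks 0 (incidence (pairClosure (G := G)))
      (incidence (pairClosure (G := G))).transpose 0 := by
  ext (i | i) (j | j) <;> simp [SimpleGraph.adjMatrix_apply, incidence]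

theorem sgbGraph_degree_inl (q : G × G) [Fintype ((sgbGraph G).neighborSet (Sum.inl q))] :
    (sgbGraph G).degree (Sum.inl q) = 1 := by
  rw [SimpleGraph.degree, Finset.card_eq_one]
  refine ⟨Sum.inr (pairClosure q), ?_⟩
  ext (x | x) <;> simp [eq_comm]

open scoped Classical in
theorem sgbGraph_degree_inr [Fintype G] (K : Subgroup G)
    [Fintype ((sgbGraph G).neighborSet (Sum.inr K))] :
    (sgbGraph G).degree (Sum.inr K) = fiberCard pairClosure K := by
  refine Eq.trans (congrArg Finset.card ?_) (Finset.card_map Function.Embedding.inl)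
  ext (x | x) <;> simp

open scoped Classical in
theorem sgbGraph_cnMatrix [Fintype (Subgroup G)] :
    cnMatrix (sgbGraph G) = Matrix.fromBlocks
      (incidence (pairClosure (G := G)) * (incidence (pairClosure (G := G))).transpose - 1)
      0 0 0 := by
  have hmul : ∀ q q' : G × G,
      (incidence (pairClosure (G := G)) * (incidence (pairClosure (G := G))).transpose) q q' =
        if pairClosure q = pairClosure q' then 1 else 0 := by
    intro q q'
    simp [Matrix.mul_apply, incidence, eq_comm]
  have hcn : ∀ v w, (sgbGraph G).commonNeighbors v w =
      {u | (sgbGraph G).Adj v u ∧ (sgbGraph G).Adj w u} := fun _ _ => rfl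
  ext (i | i) (j | j)
  · rw [cnMatrix, Matrix.of_apply, Matrix.fromBlocks_apply₁₁, Matrix.sub_apply, hmul,
      Matrix.one_apply, hcn]
    by_cases hij : i = j
    · simp [hij]
    · simp only [Sum.inl.injEq, hij, if_false, sub_zero]
      split_ifs with h
      · have : {u | (sgbGraph G).Adj (Sum.inl i) u ∧ (sgbGraph G).Adj (Sum.inl j) u} =
            {Sum.inr (pairClosure i)} := by
          ext (x | x) <;> simp [h, eq_comm]
        simp [this]
      · have : {u | (sgbGraph G).Adj (Sum.inl i) u ∧ (sgbGraph G).Adj (Sum.inl j) u} = ∅ := by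
          ext (x | x)
          · simp
          · simp only [Set.mem_ofPred_eq, sgbGraph_adj_inl_inr, Set.mem_empty_iff_false, iff_false]
            rintro ⟨h1, h2⟩
            exact h (h1.trans h2.symm)
        simp [this]
  · have : {u | (sgbGraph G).Adj (Sum.inl i) u ∧ (sgbGraph G).Adj (Sum.inr j) u} = ∅ := by
      ext (x | x) <;> simp
    simp [cnMatrix, hcn, this]
  · have : {u | (sgbGraph G).Adj (Sum.inr i) u ∧ (sgbGraph G).Adj (Sum.inl j) u} = ∅ := by
      ext (x | x) <;> simp
    simp [cnMatrix, hcn, this]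
  · by_cases hij : i = j
    · simp [cnMatrix, hij]
    · have : {u | (sgbGraph G).Adj (Sum.inr i) u ∧ (sgbGraph G).Adj (Sum.inr j) u} = ∅ := by
        ext (x | x)
        · simp only [Set.mem_ofPred_eq, sgbGraph_adj_inr_inl, Set.mem_empty_iff_false, iff_false]
          rintro ⟨h1, h2⟩
          exact hij (h1.symm.trans h2)
        · simp
      simp [cnMatrix, hcn, this, hij]

variable [Fintype G] [Fintype (Subgroup G)]

open scoped Classical in
theorem graphSpec_sgbGraph (hc : Fintype.card (Subgroup G) ≤ Fintype.card (G × G)) :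
    graphSpec (sgbGraph G) =
      Multiset.replicate (Fintype.card (G × G) - Fintype.card (Subgroup G)) 0 +
        ∑ K : Subgroup G, {√(fiberCard pairClosure K : ℝ), -√(fiberCard pairClosure K : ℝ)} := by
  rw [graphSpec, eigenvalueMultiset]
  convert roots_charpoly_adj_block (pairClosure (G := G)) hc using 3
  exact sgbGraph_adjMatrix

open scoped Classical in
theorem graphLSpec_sgbGraph (hc : Fintype.card (Subgroup G) ≤ Fintype.card (G × G)) :
    graphLSpec (sgbGraph G) =
      Multiset.replicate (Fintype.card (G × G) - Fintype.card (Subgroup G)) 1 +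
        ∑ K : Subgroup G, {(0 : ℝ), (fiberCard pairClosure K : ℝ) + 1} := by
  rw [graphLSpec, eigenvalueMultiset]
  convert roots_charpoly_lap_block (pairClosure (G := G)) hc (-1) (by norm_num) using 3
  rw [SimpleGraph.lapMatrix, sgbGraph_adjMatrix]
  ext (i | i) (j | j) <;>
    simp [SimpleGraph.degMatrix, Matrix.diagonal_apply, Matrix.one_apply, sgbGraph_degree_inl,
      sgbGraph_degree_inr]

open scoped Classical in
theorem graphQSpec_sgbGraph (hc : Fintype.card (Subgroup G) ≤ Fintype.card (G × G)) :
    graphQSpec (sgbGraph G) =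
      Multiset.replicate (Fintype.card (G × G) - Fintype.card (Subgroup G)) 1 +
        ∑ K : Subgroup G, {(0 : ℝ), (fiberCard pairClosure K : ℝ) + 1} := by
  rw [graphQSpec, eigenvalueMultiset]
  convert roots_charpoly_lap_block (pairClosure (G := G)) hc 1 (by norm_num) using 3
  rw [signlessLapMatrix, sgbGraph_adjMatrix]
  ext (i | i) (j | j) <;>
    simp [SimpleGraph.degMatrix, Matrix.diagonal_apply, Matrix.one_apply, sgbGraph_degree_inl,
      sgbGraph_degree_inr]

open scoped Classical in
theorem graphCNSpec_sgbGraph (hc : Fintype.card (Subgroup G) ≤ Fintype.card (G × G)) :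
    graphCNSpec (sgbGraph G) =
      Multiset.replicate (Fintype.card (G × G) - Fintype.card (Subgroup G)) (-1) +
        ∑ K : Subgroup G, {(0 : ℝ), (fiberCard pairClosure K : ℝ) - 1} := by
  rw [graphCNSpec, eigenvalueMultiset]
  convert roots_charpoly_cn_block (pairClosure (G := G)) hc using 3
  exact sgbGraph_cnMatrix

end Graph

/-! ### Subgroups of dihedral groups -/

section Dihedral

open DihedralGroup

variable {n : ℕ}

/-- The subgroup of rotations `r i` with `i ∈ A`. -/
def rotSub (A : AddSubgroup (ZMod n)) : Subgroup (DihedralGroup n) where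
  carrier := {x | ∃ i ∈ A, x = r i}
  one_mem' := ⟨0, A.zero_mem, rfl⟩
  mul_mem' := by
    rintro _ _ ⟨i, hi, rfl⟩ ⟨j, hj, rfl⟩
    exact ⟨i + j, A.add_mem hi hj, rfl⟩
  inv_mem' := by
    rintro _ ⟨i, hi, rfl⟩
    exact ⟨-i, A.neg_mem hi, rfl⟩

/-- The subgroup of rotations `r i` with `i ∈ A` and reflections `sr k` with `k ∈ j + A`. -/
def reflSub (A : AddSubgroup (ZMod n)) (j : ZMod n) : Subgroup (DihedralGroup n) where
  carrier := {x | (∃ i ∈ A, x = r i) ∨ ∃ k, k - j ∈ A ∧ x = sr k}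
  one_mem' := Or.inl ⟨0, A.zero_mem, rfl⟩
  mul_mem' := by
    rintro _ _ (⟨i, hi, rfl⟩ | ⟨i, hi, rfl⟩) (⟨k, hk, rfl⟩ | ⟨k, hk, rfl⟩)
    · exact Or.inl ⟨i + k, A.add_mem hi hk, rfl⟩
    · exact Or.inr ⟨k - i, by simpa [sub_right_comm] using A.sub_mem hk hi, rfl⟩
    · exact Or.inr ⟨i + k, by simpa [add_sub_right_comm] using A.add_mem hi hk, rfl⟩
    · exact Or.inl ⟨k - i, by simpa using A.sub_mem hk hi, rfl⟩
  inv_mem' := by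
    rintro _ (⟨i, hi, rfl⟩ | ⟨i, hi, rfl⟩)
    · exact Or.inl ⟨-i, A.neg_mem hi, rfl⟩
    · exact Or.inr ⟨i, hi, rfl⟩

/-- The exponents of the rotations contained in a subgroup. -/
def rotPart (K : Subgroup (DihedralGroup n)) : AddSubgroup (ZMod n) where
  carrier := {i | r i ∈ K}
  zero_mem' := K.one_mem
  add_mem' := fun hi hj => K.mul_mem hi hj
  neg_mem' := fun hi => K.inv_mem hi

@[simp] theorem mem_rotPart {K : Subgroup (DihedralGroup n)} {i : ZMod n} :
    i ∈ rotPart K ↔ r i ∈ K := Iff.rfl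

@[simp] theorem r_mem_rotSub {A : AddSubgroup (ZMod n)} {i : ZMod n} :
    r i ∈ rotSub A ↔ i ∈ A :=
  ⟨by rintro ⟨k, hk, h⟩; cases h; exact hk, fun h => ⟨i, h, rfl⟩⟩

@[simp] theorem sr_notMem_rotSub {A : AddSubgroup (ZMod n)} {i : ZMod n} :
    sr i ∉ rotSub A := by
  rintro ⟨k, hk, h⟩
  cases h

@[simp] theorem r_mem_reflSub {A : AddSubgroup (ZMod n)} {i j : ZMod n} :
    r i ∈ reflSub A j ↔ i ∈ A := by
  refine ⟨?_, fun h => Or.inl ⟨i, h, rfl⟩⟩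
  rintro (⟨k, hk, h⟩ | ⟨k, hk, h⟩) <;> cases h
  exact hk

@[simp] theorem sr_mem_reflSub {A : AddSubgroup (ZMod n)} {i j : ZMod n} :
    sr i ∈ reflSub A j ↔ i - j ∈ A := by
  refine ⟨?_, fun h => Or.inr ⟨i, h, rfl⟩⟩
  rintro (⟨k, hk, h⟩ | ⟨k, hk, h⟩) <;> cases h
  exact hk

theorem rotSub_le_iff {A : AddSubgroup (ZMod n)} {K : Subgroup (DihedralGroup n)} :
    rotSub A ≤ K ↔ A ≤ rotPart K := by
  refine ⟨fun h i hi => h (r_mem_rotSub.2 hi), ?_⟩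
  rintro h _ ⟨i, hi, rfl⟩
  exact h hi

theorem reflSub_le_iff {A : AddSubgroup (ZMod n)} {j : ZMod n} {K : Subgroup (DihedralGroup n)} :
    reflSub A j ≤ K ↔ A ≤ rotPart K ∧ sr j ∈ K := by
  refine ⟨fun h => ⟨fun i hi => h (r_mem_reflSub.2 hi), h (by simp)⟩, ?_⟩
  rintro ⟨h, hj⟩ _ (⟨i, hi, rfl⟩ | ⟨k, hk, rfl⟩)
  · exact h hi
  · have := K.mul_mem hj (h hk)
    rwa [sr_mul_r, add_sub_cancel] at this

theorem rotSub_inj {A B : AddSubgroup (ZMod n)} : rotSub A = rotSub B ↔ A = B := by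
  refine ⟨fun h => ?_, fun h => h ▸ rfl⟩
  ext i
  rw [← r_mem_rotSub, h, r_mem_rotSub]

theorem rotSub_ne_reflSub {A B : AddSubgroup (ZMod n)} {j : ZMod n} : rotSub A ≠ reflSub B j := by
  intro h
  have : sr j ∈ rotSub A := h ▸ (by simp)
  simp at this

theorem reflSub_inj {A B : AddSubgroup (ZMod n)} {j k : ZMod n} :
    reflSub A j = reflSub B k ↔ A = B ∧ j - k ∈ B := by
  constructor
  · intro h
    refine ⟨?_, ?_⟩
    · ext i
      rw [← r_mem_reflSub (j := j), h, r_mem_reflSub]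
    · rw [← sr_mem_reflSub, ← h]
      simp
  · rintro ⟨rfl, h⟩
    apply le_antisymm <;> rw [reflSub_le_iff]
    · exact ⟨fun i hi => by simpa, by simpa⟩
    · exact ⟨fun i hi => by simpa, by simpa using A.neg_mem h⟩

theorem eq_rotSub_or_reflSub (K : Subgroup (DihedralGroup n)) :
    K = rotSub (rotPart K) ∨ ∃ j, K = reflSub (rotPart K) j := by
  by_cases h : ∃ j, sr j ∈ K
  · obtain ⟨j, hj⟩ := h
    refine Or.inr ⟨j, le_antisymm ?_ (reflSub_le_iff.2 ⟨le_rfl, hj⟩)⟩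
    rintro (i | i) hi
    · simpa
    · simpa using K.mul_mem hj hi
  · refine Or.inl (le_antisymm ?_ (rotSub_le_iff.2 le_rfl))
    rintro (i | i) hi
    · simpa
    · exact absurd ⟨i, hi⟩ h

/-- Every subgroup of a dihedral group is either `rotSub A` or `reflSub A j`, for unique `A` and
`j` modulo `A`. -/
theorem bijective_subgroup_param :
    Function.Bijective (fun t : (A : AddSubgroup (ZMod n)) × Option (ZMod n ⧸ A) =>
      t.2.elim (rotSub t.1) fun c => reflSub t.1 c.out) := by
  constructor
  · rintro ⟨A, _ | c⟩ ⟨B, _ | d⟩ h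
    · obtain rfl := rotSub_inj.1 h
      rfl
    · exact absurd h rotSub_ne_reflSub
    · exact absurd h.symm rotSub_ne_reflSub
    · obtain ⟨rfl, h⟩ := reflSub_inj.1 h
      have : (c.out : ZMod n ⧸ A) = d.out := by
        rw [eq_comm, QuotientAddGroup.eq_iff_sub_mem]
        simpa using A.neg_mem h
      simp only [QuotientAddGroup.out_eq'] at this
      rw [this]
  · intro K
    rcases eq_rotSub_or_reflSub K with h | ⟨j, h⟩
    · exact ⟨⟨rotPart K, none⟩, h.symm⟩
    · refine ⟨⟨rotPart K, some (j : ZMod n ⧸ rotPart K)⟩, ?_⟩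
      refine Eq.trans (reflSub_inj.2 ⟨rfl, ?_⟩) h.symm
      rw [← QuotientAddGroup.eq_iff_sub_mem]
      simp

theorem pairClosure_r_r (i j : ZMod n) :
    pairClosure (r i, r j) = rotSub (AddSubgroup.closure {i, j}) := by
  apply le_antisymm
  · rw [pairClosure, Subgroup.closure_le]
    rintro _ (rfl | rfl)
    · exact r_mem_rotSub.2 (AddSubgroup.subset_closure (by simp))
    · exact r_mem_rotSub.2 (AddSubgroup.subset_closure (by simp))
  · rw [rotSub_le_iff, AddSubgroup.closure_le]
    rintro _ (rfl | rfl)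
    · exact Subgroup.subset_closure (by simp)
    · exact Subgroup.subset_closure (by simp)

theorem pairClosure_r_sr (i j : ZMod n) :
    pairClosure (r i, sr j) = reflSub (AddSubgroup.zmultiples i) j := by
  apply le_antisymm
  · rw [pairClosure, Subgroup.closure_le]
    rintro _ (rfl | rfl)
    · exact r_mem_reflSub.2 (AddSubgroup.mem_zmultiples i)
    · exact sr_mem_reflSub.2 (by simp)
  · rw [reflSub_le_iff, AddSubgroup.zmultiples_le]
    exact ⟨Subgroup.subset_closure (by simp), Subgroup.subset_closure (by simp)⟩

theorem pairClosure_sr_r (i j : ZMod n) :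
    pairClosure (sr j, r i) = reflSub (AddSubgroup.zmultiples i) j := by
  rw [← pairClosure_r_sr, pairClosure, pairClosure, Set.pair_comm]

theorem pairClosure_sr_sr (j k : ZMod n) :
    pairClosure (sr j, sr k) = reflSub (AddSubgroup.zmultiples (k - j)) j := by
  apply le_antisymm
  · rw [pairClosure, Subgroup.closure_le]
    rintro _ (rfl | rfl)
    · exact sr_mem_reflSub.2 (by simp)
    · exact sr_mem_reflSub.2 (AddSubgroup.mem_zmultiples _)
  · have hj : sr j ∈ pairClosure (sr j, sr k) := Subgroup.subset_closure (by simp)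
    have hk : sr k ∈ pairClosure (sr j, sr k) := Subgroup.subset_closure (by simp)
    rw [reflSub_le_iff, AddSubgroup.zmultiples_le]
    exact ⟨Subgroup.mul_mem _ hj hk, hj⟩

variable [NeZero n]

theorem sum_dihedralGroup {M : Type*} [AddCommMonoid M] (F : DihedralGroup n → M) :
    ∑ x, F x = ∑ i, F (r i) + ∑ i, F (sr i) := by
  rw [← equivSum.symm.sum_comp F, Fintype.sum_sum_type]
  rfl

open scoped Classical in
theorem fiberCard_eq_sum (K : Subgroup (DihedralGroup n)) :
    fiberCard pairClosure K =
      (∑ i : ZMod n, ∑ j : ZMod n, if pairClosure (r i, r j) = K then 1 else 0) +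
      (∑ i : ZMod n, ∑ j : ZMod n, if pairClosure (r i, sr j) = K then 1 else 0) +
      ((∑ j : ZMod n, ∑ i : ZMod n, if pairClosure (sr j, r i) = K then 1 else 0) +
      (∑ j : ZMod n, ∑ k : ZMod n, if pairClosure (sr j, sr k) = K then 1 else 0)) := by
  rw [fiberCard, Finset.card_filter, Fintype.sum_prod_type, sum_dihedralGroup]
  simp_rw [sum_dihedralGroup, Finset.sum_add_distrib]

open scoped Classical in
theorem fiberCard_rotSub (A : AddSubgroup (ZMod n)) :
    fiberCard pairClosure (rotSub A) =
      (Finset.univ.filter fun q : ZMod n × ZMod n => AddSubgroup.closure {q.1, q.2} = A).card := by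
  rw [fiberCard_eq_sum, Finset.card_filter, Fintype.sum_prod_type]
  simp [pairClosure_r_r, pairClosure_r_sr, pairClosure_sr_r, pairClosure_sr_sr, rotSub_inj,
    rotSub_ne_reflSub.symm]

open scoped Classical in
/-- A pair generating `reflSub A j₀` has one of the forms `(r i, sr j)`, `(sr j, r i)` and
`(sr j, sr (j + i))`, and in each case the condition is that `j` lies in `j₀ + A` and that `i`
generates `A`. -/
theorem fiberCard_reflSub (A : AddSubgroup (ZMod n)) (j₀ : ZMod n) :
    fiberCard pairClosure (reflSub A j₀) =
      3 * (Nat.card A *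
        (Finset.univ.filter fun i : ZMod n => AddSubgroup.zmultiples i = A).card) := by
  have hA : (∑ j : ZMod n, if j - j₀ ∈ A then 1 else 0) = Nat.card A := by
    refine (Fintype.sum_equiv (Equiv.subRight j₀) _ (fun j => if j ∈ A then 1 else 0)
      fun _ => rfl).trans ?_
    rw [← Finset.card_filter, Nat.card_eq_fintype_card, Fintype.card_subtype]
  have hprod : (∑ j : ZMod n, ∑ i : ZMod n,
      if AddSubgroup.zmultiples i = A ∧ j - j₀ ∈ A then 1 else 0) = Nat.card A *
        (Finset.univ.filter fun i : ZMod n => AddSubgroup.zmultiples i = A).card := by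
    rw [← hA, Finset.card_filter, Finset.sum_mul_sum]
    refine Finset.sum_congr rfl fun j _ => Finset.sum_congr rfl fun i _ => ?_
    split_ifs <;> simp_all
  have hsr : (∑ j : ZMod n, ∑ k : ZMod n,
      if AddSubgroup.zmultiples (k - j) = A ∧ j - j₀ ∈ A then 1 else 0) =
      ∑ j : ZMod n, ∑ i : ZMod n,
        if AddSubgroup.zmultiples i = A ∧ j - j₀ ∈ A then 1 else 0 :=
    Finset.sum_congr rfl fun j _ => Fintype.sum_equiv (Equiv.subRight j) _ _ fun _ => rfl
  rw [fiberCard_eq_sum]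
  simp only [pairClosure_r_r, pairClosure_r_sr, pairClosure_sr_r, pairClosure_sr_sr, reflSub_inj,
    rotSub_ne_reflSub, if_false, Finset.sum_const_zero]
  have hcomm : (∑ i : ZMod n, ∑ j : ZMod n,
      if AddSubgroup.zmultiples i = A ∧ j - j₀ ∈ A then 1 else 0) = Nat.card A *
        (Finset.univ.filter fun i : ZMod n => AddSubgroup.zmultiples i = A).card := by
    rw [Finset.sum_comm, hprod]
  rw [hsr, hcomm, hprod]
  ring

open scoped Classical in
/-- Sums over the subgroups of a dihedral group of a function of the number of generating pairs. -/
theorem sum_fiberCard_subgroup {M : Type*} [AddCommMonoid M]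
    [Fintype (Subgroup (DihedralGroup n))] [Fintype (AddSubgroup (ZMod n))] (φ : ℕ → M) :
    ∑ K : Subgroup (DihedralGroup n), φ (fiberCard pairClosure K) =
      ∑ A : AddSubgroup (ZMod n),
        (φ (Finset.univ.filter fun q : ZMod n × ZMod n =>
            AddSubgroup.closure {q.1, q.2} = A).card +
          A.index • φ (3 * (Nat.card A *
            (Finset.univ.filter fun i : ZMod n => AddSubgroup.zmultiples i = A).card))) := by
  rw [← (Equiv.ofBijective _ (bijective_subgroup_param (n := n))).sum_comp, Fintype.sum_sigma]
  refine Finset.sum_congr rfl fun A _ => ?_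
  simp [Fintype.sum_option, fiberCard_rotSub, fiberCard_reflSub, AddSubgroup.index_eq_card]

end Dihedral

/-! ### Subgroups and generators of `ZMod (p ^ 2)` -/

section ZModPrimeSq

variable (p : ℕ) [hp : Fact p.Prime]

/-- The subgroup of order `p` of `ZMod (p ^ 2)`. -/
def midSub : AddSubgroup (ZMod (p ^ 2)) := AddSubgroup.zmultiples (p : ZMod (p ^ 2))

theorem card_midSub : Nat.card (midSub p) = p := by
  have hp0 := hp.out.pos
  rw [midSub, Nat.card_zmultiples, ZMod.addOrderOf_coe _ (by positivity),
    Nat.gcd_eq_right (Dvd.intro_left (p ^ 1) (by ring)), pow_two, Nat.mul_div_cancel _ hp0]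

theorem eq_midSub_of_card (A : AddSubgroup (ZMod (p ^ 2))) (hA : Nat.card A = p) :
    A = midSub p := by
  classical
  -- A subgroup of order `p` consists of `p`-torsion, and a cyclic group has at most `p` elements
  -- killed by `p`.
  let T : AddSubgroup (ZMod (p ^ 2)) := (nsmulAddMonoidHom p).ker
  have hle : ∀ B : AddSubgroup (ZMod (p ^ 2)), Nat.card B = p → B = T := by
    intro B hB
    refine AddSubgroup.eq_of_le_of_card_ge (fun x hx => ?_) ?_
    · have := card_nsmul_eq_zero' (x := (⟨x, hx⟩ : B))
      rw [hB] at this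
      simpa [T, AddMonoidHom.mem_ker] using congrArg Subtype.val this
    · rw [hB, Nat.card_eq_fintype_card, Fintype.card_subtype]
      convert IsAddCyclic.card_nsmul_eq_zero_le (α := ZMod (p ^ 2)) hp.out.pos using 2
      ext x
      simp [T, AddMonoidHom.mem_ker]
  rw [hle A hA, hle _ (card_midSub p)]

theorem eq_bot_or_midSub_or_top (A : AddSubgroup (ZMod (p ^ 2))) :
    A = ⊥ ∨ A = midSub p ∨ A = ⊤ := by
  have h := A.card_addSubgroup_dvd_card
  rw [Nat.card_zmod, Nat.dvd_prime_pow hp.out] at h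
  obtain ⟨k, hk, h⟩ := h
  interval_cases k
  · exact Or.inl (AddSubgroup.card_eq_one.1 (by simpa using h))
  · exact Or.inr (Or.inl (eq_midSub_of_card p A (by simpa using h)))
  · exact Or.inr (Or.inr (AddSubgroup.eq_top_of_card_eq _ (by rw [h, Nat.card_zmod])))

theorem midSub_ne_bot : midSub p ≠ ⊥ := by
  intro h
  have := card_midSub p
  rw [h, AddSubgroup.card_bot] at this
  exact hp.out.one_lt.ne this

theorem midSub_ne_top : midSub p ≠ ⊤ := by
  intro h
  have := card_midSub p
  rw [h, AddSubgroup.card_top, Nat.card_zmod] at this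
  nlinarith [hp.out.one_lt]

theorem top_ne_bot_zmod : (⊤ : AddSubgroup (ZMod (p ^ 2))) ≠ ⊥ := by
  intro h
  exact midSub_ne_bot p (le_bot_iff.1 (h ▸ le_top))

open scoped Classical in
theorem sum_addSubgroup_zmod [Fintype (AddSubgroup (ZMod (p ^ 2)))] {M : Type*} [AddCommMonoid M]
    (F : AddSubgroup (ZMod (p ^ 2)) → M) : ∑ A, F A = F ⊥ + (F (midSub p) + F ⊤) := by
  have : (Finset.univ : Finset (AddSubgroup (ZMod (p ^ 2)))) = {⊥, midSub p, ⊤} := by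
    ext A
    simpa using eq_bot_or_midSub_or_top p A
  rw [this, Finset.sum_insert, Finset.sum_pair (midSub_ne_top p)]
  simp [(midSub_ne_bot p).symm, (top_ne_bot_zmod p).symm]

section Counting

variable {X : Type*} [Fintype X] (g : X → AddSubgroup (ZMod (p ^ 2)))

open scoped Classical in
/-- The fiber over a member of the chain `⊥ < midSub p < ⊤` is counted by subtracting, from the
number of points with value at most that member, the number of those with value at most the
preceding one. -/
theorem card_filter_eq_midSub :
    (Finset.univ.filter fun x => g x = midSub p).card =
      (Finset.univ.filter fun x => g x ≤ midSub p).card -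
        (Finset.univ.filter fun x => g x = ⊥).card := by
  rw [← Finset.card_sdiff_of_subset]
  · congr 1
    ext x
    simp only [Finset.mem_filter_univ, Finset.mem_sdiff]
    rcases eq_bot_or_midSub_or_top p (g x) with h | h | h
    · simp [h, (midSub_ne_bot p).symm]
    · simp [h, midSub_ne_bot p]
    · simp [h, (midSub_ne_top p).symm, midSub_ne_top p]
  · intro x
    simp only [Finset.mem_filter_univ]
    intro h
    simp [h]

open scoped Classical in
theorem card_filter_eq_top :
    (Finset.univ.filter fun x => g x = ⊤).card =
      Fintype.card X - (Finset.univ.filter fun x => g x ≤ midSub p).card := by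
  rw [← Finset.card_compl]
  congr 1
  ext x
  simp only [Finset.mem_filter_univ, Finset.mem_compl]
  rcases eq_bot_or_midSub_or_top p (g x) with h | h | h
  · simp [h, (top_ne_bot_zmod p).symm]
  · simp [h, midSub_ne_top p]
  · simp [h, midSub_ne_top p]

end Counting

open scoped Classical in
theorem card_filter_mem_midSub :
    (Finset.univ.filter fun i : ZMod (p ^ 2) => i ∈ midSub p).card = p := by
  rw [← Fintype.card_subtype, ← Nat.card_eq_fintype_card]
  exact card_midSub p

open scoped Classical in
theorem card_generators_bot :
    (Finset.univ.filter fun i : ZMod (p ^ 2) => AddSubgroup.zmultiples i = ⊥).card = 1 := by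
  simp [Finset.filter_eq']

open scoped Classical in
theorem card_generators_midSub :
    (Finset.univ.filter fun i : ZMod (p ^ 2) => AddSubgroup.zmultiples i = midSub p).card =
      p - 1 := by
  rw [card_filter_eq_midSub, card_generators_bot]
  simp_rw [AddSubgroup.zmultiples_le]
  rw [card_filter_mem_midSub]

open scoped Classical in
theorem card_generators_top :
    (Finset.univ.filter fun i : ZMod (p ^ 2) => AddSubgroup.zmultiples i = ⊤).card =
      p ^ 2 - p := by
  rw [card_filter_eq_top]
  simp_rw [AddSubgroup.zmultiples_le]
  rw [card_filter_mem_midSub, ZMod.card]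

open scoped Classical in
theorem card_generatingPairs_bot :
    (Finset.univ.filter fun q : ZMod (p ^ 2) × ZMod (p ^ 2) =>
      AddSubgroup.closure {q.1, q.2} = ⊥).card = 1 := by
  rw [Finset.card_eq_one]
  refine ⟨(0, 0), ?_⟩
  ext ⟨i, j⟩
  simp [AddSubgroup.closure_eq_bot_iff]

open scoped Classical in
theorem card_pairs_le_midSub :
    (Finset.univ.filter fun q : ZMod (p ^ 2) × ZMod (p ^ 2) =>
      AddSubgroup.closure {q.1, q.2} ≤ midSub p).card = p ^ 2 := by
  have : (Finset.univ.filter fun q : ZMod (p ^ 2) × ZMod (p ^ 2) =>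
      AddSubgroup.closure {q.1, q.2} ≤ midSub p) =
      (Finset.univ.filter fun i : ZMod (p ^ 2) => i ∈ midSub p) ×ˢ
        (Finset.univ.filter fun i : ZMod (p ^ 2) => i ∈ midSub p) := by
    ext ⟨i, j⟩
    simp [AddSubgroup.closure_le, Set.insert_subset_iff]
  rw [this, Finset.card_product, card_filter_mem_midSub, pow_two]

open scoped Classical in
theorem card_generatingPairs_midSub :
    (Finset.univ.filter fun q : ZMod (p ^ 2) × ZMod (p ^ 2) =>
      AddSubgroup.closure {q.1, q.2} = midSub p).card = p ^ 2 - 1 := by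
  rw [card_filter_eq_midSub, card_generatingPairs_bot, card_pairs_le_midSub]

open scoped Classical in
theorem card_generatingPairs_top :
    (Finset.univ.filter fun q : ZMod (p ^ 2) × ZMod (p ^ 2) =>
      AddSubgroup.closure {q.1, q.2} = ⊤).card = p ^ 4 - p ^ 2 := by
  rw [card_filter_eq_top, card_pairs_le_midSub, Fintype.card_prod, ZMod.card]
  ring_nf

theorem index_midSub : (midSub p).index = p := by
  have h := (midSub p).card_mul_index
  rw [card_midSub, Nat.card_zmod] at h
  exact Nat.eq_of_mul_eq_mul_left hp.out.pos (h.trans (pow_two p))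

/-! ### The spectra for the dihedral group of order `2 * p ^ 2` -/

open scoped Classical in
/-- The star sizes, with multiplicity. In the order of the right-hand side: the rotation subgroups
of orders `1`, `p` and `p ^ 2`, the `p ^ 2` subgroups generated by a reflection, the `p` dihedral
subgroups of order `2 * p`, and the whole group. -/
theorem sum_fiberCard_dihedral [Fintype (Subgroup (DihedralGroup (p ^ 2)))] {M : Type*}
    [AddCommMonoid M] (φ : ℝ → M) :
    ∑ K : Subgroup (DihedralGroup (p ^ 2)), φ (fiberCard pairClosure K) =
      φ 1 + φ ((p : ℝ) ^ 2 - 1) + φ ((p : ℝ) ^ 4 - (p : ℝ) ^ 2) + p ^ 2 • φ 3 +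
        p • φ (3 * (p : ℝ) ^ 2 - 3 * (p : ℝ)) + φ (3 * (p : ℝ) ^ 4 - 3 * (p : ℝ) ^ 3) := by
  have h1 : 1 ≤ p := hp.out.pos
  have h2 : 1 ≤ p ^ 2 := Nat.one_le_pow _ _ h1
  have h3 : p ≤ p ^ 2 := Nat.le_self_pow two_ne_zero p
  have h4 : p ^ 2 ≤ p ^ 4 := Nat.pow_le_pow_right h1 (by norm_num)
  rw [sum_fiberCard_subgroup (fun m => φ (m : ℝ)), sum_addSubgroup_zmod p,
    card_generators_bot, card_generators_midSub, card_generators_top, card_generatingPairs_bot,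
    card_generatingPairs_midSub, card_generatingPairs_top, index_midSub, card_midSub,
    AddSubgroup.index_bot, AddSubgroup.index_top, AddSubgroup.card_bot, AddSubgroup.card_top,
    Nat.card_zmod]
  push_cast [h1, h2, h3, h4]
  have e1 : (3 * (p * (p - 1)) : ℝ) = 3 * (p : ℝ) ^ 2 - 3 * (p : ℝ) := by ring
  have e2 : (3 * (p ^ 2 * (p ^ 2 - p)) : ℝ) = 3 * (p : ℝ) ^ 4 - 3 * (p : ℝ) ^ 3 := by ring
  rw [e1, e2, one_smul]
  abel

theorem card_subgroup_dihedral [Fintype (Subgroup (DihedralGroup (p ^ 2)))] :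
    Fintype.card (Subgroup (DihedralGroup (p ^ 2))) = p ^ 2 + p + 4 := by
  have h := sum_fiberCard_dihedral p (fun _ => (1 : ℕ))
  rw [Finset.sum_const, Finset.card_univ] at h
  simp only [smul_eq_mul, mul_one] at h
  omega

theorem card_prod_dihedral :
    Fintype.card (DihedralGroup (p ^ 2) × DihedralGroup (p ^ 2)) = 4 * p ^ 4 := by
  rw [Fintype.card_prod, DihedralGroup.card]
  ring

end ZModPrimeSq

theorem mainTheorem2 (p : ℕ) [Fact p.Prime] :
    graphSpec (sgbGraph (DihedralGroup (p ^ 2))) =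
        Multiset.replicate (4 * p ^ 4 - p ^ 2 - p - 4) (0 : ℝ)
        + Multiset.replicate 1 (-1 : ℝ)
        + Multiset.replicate 1 (1 : ℝ)
        + Multiset.replicate (p ^ 2) (Real.sqrt 3)
        + Multiset.replicate (p ^ 2) (-Real.sqrt 3)
        + Multiset.replicate 1 (Real.sqrt ((p : ℝ) ^ 2 - 1))
        + Multiset.replicate 1 (-Real.sqrt ((p : ℝ) ^ 2 - 1))
        + Multiset.replicate 1 (Real.sqrt ((p : ℝ) ^ 4 - (p : ℝ) ^ 2))
        + Multiset.replicate 1 (-Real.sqrt ((p : ℝ) ^ 4 - (p : ℝ) ^ 2))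
        + Multiset.replicate p (Real.sqrt (3 * (p : ℝ) ^ 2 - 3 * (p : ℝ)))
        + Multiset.replicate p (-Real.sqrt (3 * (p : ℝ) ^ 2 - 3 * (p : ℝ)))
        + Multiset.replicate 1 (Real.sqrt (3 * (p : ℝ) ^ 4 - 3 * (p : ℝ) ^ 3))
        + Multiset.replicate 1 (-Real.sqrt (3 * (p : ℝ) ^ 4 - 3 * (p : ℝ) ^ 3)) ∧
    graphLSpec (sgbGraph (DihedralGroup (p ^ 2))) =
        Multiset.replicate (p ^ 2 + p + 4) (0 : ℝ)
        + Multiset.replicate (4 * p ^ 4 - p ^ 2 - p - 4) (1 : ℝ)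
        + Multiset.replicate 1 (2 : ℝ)
        + Multiset.replicate (p ^ 2) (4 : ℝ)
        + Multiset.replicate 1 ((p : ℝ) ^ 2)
        + Multiset.replicate 1 ((p : ℝ) ^ 4 - (p : ℝ) ^ 2 + 1)
        + Multiset.replicate p (3 * (p : ℝ) ^ 2 - 3 * (p : ℝ) + 1)
        + Multiset.replicate 1 (3 * (p : ℝ) ^ 4 - 3 * (p : ℝ) ^ 3 + 1) ∧
    graphLSpec (sgbGraph (DihedralGroup (p ^ 2))) =
        graphQSpec (sgbGraph (DihedralGroup (p ^ 2))) ∧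
    graphCNSpec (sgbGraph (DihedralGroup (p ^ 2))) =
        Multiset.replicate (p ^ 2 + p + 5) (0 : ℝ)
        + Multiset.replicate (4 * p ^ 4 - p ^ 2 - p - 4) (-1 : ℝ)
        + Multiset.replicate (p ^ 2) (2 : ℝ)
        + Multiset.replicate 1 ((p : ℝ) ^ 2 - 2)
        + Multiset.replicate 1 ((p : ℝ) ^ 4 - (p : ℝ) ^ 2 - 1)
        + Multiset.replicate p (3 * (p : ℝ) ^ 2 - 3 * (p : ℝ) - 1)
        + Multiset.replicate 1 (3 * (p : ℝ) ^ 4 - 3 * (p : ℝ) ^ 3 - 1) := by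

  have hcard : Fintype.card (DihedralGroup (p ^ 2) × DihedralGroup (p ^ 2)) -
      Fintype.card (Subgroup (DihedralGroup (p ^ 2))) = 4 * p ^ 4 - p ^ 2 - p - 4 := by
    rw [card_prod_dihedral, card_subgroup_dihedral]
    omega
  have hc : Fintype.card (Subgroup (DihedralGroup (p ^ 2))) ≤
      Fintype.card (DihedralGroup (p ^ 2) × DihedralGroup (p ^ 2)) := by
    rw [card_prod_dihedral, card_subgroup_dihedral]
    have h2 : 2 ≤ p := (Fact.out : p.Prime).two_le
    have h3 : 2 ^ 2 ≤ p ^ 2 := Nat.pow_le_pow_left h2 2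
    nlinarith
  have hpair : ∀ a b : ℝ, ({a, b} : Multiset ℝ) = {a} + {b} := fun _ _ => rfl
  -- With singletons as atoms, each claim is an identity of linear combinations over `ℕ`.
  refine ⟨?_, ?_, ?_, ?_⟩
  · rw [graphSpec_sgbGraph hc, hcard, sum_fiberCard_dihedral p fun m => {√m, -√m}]
    simp only [hpair, Real.sqrt_one, ← Multiset.nsmul_singleton]
    module
  · rw [graphLSpec_sgbGraph hc, hcard, sum_fiberCard_dihedral p fun m => {0, m + 1}]
    have e1 : (1 + 1 : ℝ) = 2 := by norm_num
    have e2 : (3 + 1 : ℝ) = 4 := by norm_num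
    simp only [hpair, sub_add_cancel, e1, e2, ← Multiset.nsmul_singleton]
    module
  · rw [graphLSpec_sgbGraph hc, graphQSpec_sgbGraph hc]
  · rw [graphCNSpec_sgbGraph hc, hcard, sum_fiberCard_dihedral p fun m => {0, m - 1}]
    have e1 : (p : ℝ) ^ 2 - 1 - 1 = (p : ℝ) ^ 2 - 2 := by ring
    have e2 : (3 - 1 : ℝ) = 2 := by norm_num
    simp only [hpair, sub_self, e1, e2, ← Multiset.nsmul_singleton]
    module
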